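/- All matrices are complex square matrices of arbitrary finite size. For a self-adjoint matrix $X$ with spectrum in a set $E\subseteq\mathbb{R}$ and $g:E\to\mathbb{R}$, $g(X)$ is defined by diagonalization: $g(U^*\operatorname{diag}(\lambda_1,\dots,\lambda_n)U)=U^*\operatorname{diag}(g(\lambda_1),\dots,g(\lambda_n))U$ for unitary $U$. For self-adjoint matrices of the same size, $A\le B$ means that $B-A$ is positive semidefinite. A function $g:E\to\mathbb{R}$ is called \emph{matrix monotone} on $E$ if $g(A)\le g(B)$ for all self-adjoint matrices $A\le B$ of the same size with spectrum in $E$. A function $f:E\to\mathbb{R}$ is called \emph{trace minmax} if $$\operatorname{tr}\bigl(f(A)+f(C)\bigr)\ \ge\ \operatorname{tr}\bigl(f(B)+f(D)\bigr),\qquad D=A+C-B,$$ for all self-adjoint matrices $A\le B\le C$ of the same size with spectrum in $E$ (then $A\le D\le C$, so $D$ has spectrum in $E$ as well when $E$ is an interval). \textbf{Theorem.} Let $-\infty\le a<b\le\infty$ and let $f:(a,b)\to\mathbb{R}$ be a Lebesgue measurable function; no continuity or smoothness is assumed. Then $f$ is trace minmax if and only if $f$ is differentiable at every point of $(a,b)$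 and its derivative $f'$ is matrix monotone on $(a,b)$. -/

import Mathlib

open scoped ComplexOrder

/-- The open interval `(a, b)` of real numbers, with endpoints in `[-∞, ∞]`. -/
def realInterval (a b : EReal) : Set ℝ :=
  {x : ℝ | a < (x : EReal) ∧ (x : EReal) < b}

/-- The Löwner order on self-adjoint complex matrices: `B - A` is positive semidefinite. -/
def LoewnerLE {n : ℕ} (A B : Matrix (Fin n) (Fin n) ℂ) : Prop :=
  (B - A).PosSemidef

/-- The function `f` is trace minmax on `E`:
`tr (f(A) + f(C)) ≥ tr (f(B) + f(A + C - B))` for all self-adjoint `A ≤ B ≤ C` of the same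
(arbitrary) size with spectrum in `E`. The matrix functional calculus is `cfc`; every function is
continuous on the finite spectrum of a matrix, so it applies to every `f`. These traces are real. -/
def TraceMinmaxOn (E : Set ℝ) (f : ℝ → ℝ) : Prop :=
  ∀ (n : ℕ) (A B C D : Matrix (Fin n) (Fin n) ℂ),
    A.IsHermitian → B.IsHermitian → C.IsHermitian →
    spectrum ℝ A ⊆ E → spectrum ℝ B ⊆ E → spectrum ℝ C ⊆ E →
    LoewnerLE A B → LoewnerLE B C → D = A + C - B →
    (cfc f B + cfc f D).trace.re ≤ (cfc f A + cfc f C).trace.re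

/-- The function `g` is matrix monotone on `E`: `A ≤ B` implies `g(A) ≤ g(B)` for all self-adjoint
`A`, `B` of the same (arbitrary) size with spectrum in `E`. -/
def MatrixMonotoneOn (E : Set ℝ) (g : ℝ → ℝ) : Prop :=
  ∀ (n : ℕ) (A B : Matrix (Fin n) (Fin n) ℂ),
    A.IsHermitian → B.IsHermitian → spectrum ℝ A ⊆ E → spectrum ℝ B ⊆ E →
    LoewnerLE A B → LoewnerLE (cfc g A) (cfc g B)

/-! Both directions compare traces through Klein's inequality `trace_cfc_mul_sub_le`: if `g` is a
subgradient of `f`, then tr g(A)(B - A) ≤ tr f(B) - tr f(A). No derivative of a matrix function is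
needed.

If `f'` is matrix monotone, `f` is convex with subgradient `g = f'`. With Δ = B - A, the segments
from A to B and from D to C have the same direction Δ ≥ 0, and the second lies above the first.
Heuristically, the trace gap is the integral of tr (g(D + tΔ) - g(A + tΔ))Δ ≥ 0; a Riemann sum with
Klein's inequality makes this exact.

Conversely, 1×1 matrices make `f` midpoint convex, and measurability upgrades this to convexity. A
2×2 example excludes corners, so `f` is differentiable and `f'` is continuous. For small t > 0,
apply the minmax inequality to A ≤ A + tX ≤ C; Klein's inequality at both ends gives tr f'(A)X ≤ tr
f'(C)X for every X ≥ 0. -/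

/-! ### Spectral trace formula and Klein's inequality. -/

section TraceFormula

open Matrix

variable {n : ℕ} {A B : Matrix (Fin n) (Fin n) ℂ}

/-- The squared moduli of the inner products of the eigenvectors of `A` and `B`. -/
noncomputable def eigenOverlap (hA : A.IsHermitian) (hB : B.IsHermitian) (i j : Fin n) : ℝ :=
  Complex.normSq
    ((star (hA.eigenvectorUnitary : Matrix (Fin n) (Fin n) ℂ) *
      (hB.eigenvectorUnitary : Matrix (Fin n) (Fin n) ℂ)) i j)

theorem eigenOverlap_nonneg (hA : A.IsHermitian) (hB : B.IsHermitian) (i j : Fin n) :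
    0 ≤ eigenOverlap hA hB i j :=
  Complex.normSq_nonneg _

/-- Trace inequalities become scalar inequalities in the eigenvalues, averaged with nonnegative
weights. -/
theorem trace_cfc_mul_cfc (hA : A.IsHermitian) (hB : B.IsHermitian) (g h : ℝ → ℝ) :
    (cfc g A * cfc h B).trace.re =
      ∑ i, ∑ j, g (hA.eigenvalues i) * h (hB.eigenvalues j) * eigenOverlap hA hB i j := by
  set U : Matrix (Fin n) (Fin n) ℂ := hA.eigenvectorUnitary.1 with hU
  set V : Matrix (Fin n) (Fin n) ℂ := hB.eigenvectorUnitary.1 with hV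
  have e : (cfc g A * cfc h B).trace =
      (diagonal (RCLike.ofReal ∘ g ∘ hA.eigenvalues) * ((star U * V) *
        (diagonal (RCLike.ofReal ∘ h ∘ hB.eigenvalues) * (star U * V)ᴴ))).trace := by
    rw [hA.cfc_eq, hB.cfc_eq, IsHermitian.cfc, IsHermitian.cfc, Unitary.conjStarAlgAut_apply,
      Unitary.conjStarAlgAut_apply, ← hU, ← hV, conjTranspose_mul, ← star_eq_conjTranspose,
      ← star_eq_conjTranspose, star_star, Matrix.mul_assoc, Matrix.mul_assoc, trace_mul_comm U]
    simp only [Matrix.mul_assoc]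
  rw [e, trace, Complex.re_sum]
  refine Finset.sum_congr rfl fun i _ => ?_
  rw [diag_apply, diagonal_mul, Matrix.mul_apply, Finset.mul_sum, Complex.re_sum]
  refine Finset.sum_congr rfl fun j _ => ?_
  rw [diagonal_mul, conjTranspose_apply, eigenOverlap, ← hU, ← hV]
  have := Complex.mul_conj ((star U * V) i j)
  simp only [Function.comp_apply, RCLike.star_def]
  rw [mul_left_comm ((star U * V) i j), this]
  simp [mul_assoc]

theorem cfc_id_eq (hA : A.IsHermitian) : cfc (fun x : ℝ => x) A = A :=
  cfc_id' ℝ A hA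

theorem cfc_one_eq (hA : A.IsHermitian) : cfc (fun _ : ℝ => (1 : ℝ)) A = 1 :=
  cfc_const_one ℝ A hA

/-- Klein's inequality, for a subgradient `g` of `f` on `E`. -/
theorem trace_cfc_mul_sub_le {E : Set ℝ} {f g : ℝ → ℝ}
    (hfg : ∀ x ∈ E, ∀ y ∈ E, g x * (y - x) ≤ f y - f x)
    (hA : A.IsHermitian) (hB : B.IsHermitian) (hAE : spectrum ℝ A ⊆ E) (hBE : spectrum ℝ B ⊆ E) :
    (cfc g A * (B - A)).trace.re ≤ (cfc f B).trace.re - (cfc f A).trace.re := by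
  -- Inserting the identity as a function of `A` or `B` puts all four traces over the same weights,
  -- so they compare term by term.
  have h1 : (cfc g A * B).trace.re = (cfc g A * cfc (fun x : ℝ => x) B).trace.re := by
    rw [cfc_id_eq (A := B) hB]
  have h2 : (cfc g A * A).trace.re =
      (cfc (fun x => g x * x) A * cfc (fun _ : ℝ => (1 : ℝ)) B).trace.re := by
    have hc : ContinuousOn g (spectrum ℝ A) := A.finite_real_spectrum.continuousOn _
    rw [cfc_one_eq hB, mul_one, cfc_mul g (fun x => x) A hc, cfc_id_eq hA]
  have h3 : (cfc f B).trace.re = (cfc (fun _ : ℝ => (1 : ℝ)) A * cfc f B).trace.re := by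
    rw [cfc_one_eq hA, one_mul]
  have h4 : (cfc f A).trace.re = (cfc f A * cfc (fun _ : ℝ => (1 : ℝ)) B).trace.re := by
    rw [cfc_one_eq hB, mul_one]
  rw [mul_sub, trace_sub, Complex.sub_re, h1, h2, h3, h4, trace_cfc_mul_cfc hA hB,
    trace_cfc_mul_cfc hA hB, trace_cfc_mul_cfc hA hB, trace_cfc_mul_cfc hA hB]
  simp only [← Finset.sum_sub_distrib]
  refine Finset.sum_le_sum fun i _ => Finset.sum_le_sum fun j _ => ?_
  have := mul_le_mul_of_nonneg_right
    (hfg _ (hAE (hA.eigenvalues_mem_spectrum_real i)) _ (hBE (hB.eigenvalues_mem_spectrum_real j)))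
    (eigenOverlap_nonneg hA hB i j)
  linarith

theorem Matrix.PosSemidef.trace_mul_nonneg {P Q : Matrix (Fin n) (Fin n) ℂ} (hP : P.PosSemidef)
    (hQ : Q.PosSemidef) : 0 ≤ (P * Q).trace.re := by
  rw [← cfc_id_eq hP.1, ← cfc_id_eq hQ.1, trace_cfc_mul_cfc hP.1 hQ.1]
  exact Finset.sum_nonneg fun i _ => Finset.sum_nonneg fun j _ =>
    mul_nonneg (mul_nonneg (hP.eigenvalues_nonneg i) (hQ.eigenvalues_nonneg j))
      (eigenOverlap_nonneg _ _ i j)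

theorem Matrix.IsHermitian.posSemidef_of_trace_mul_nonneg {M : Matrix (Fin n) (Fin n) ℂ}
    (hM : M.IsHermitian)
    (h : ∀ X : Matrix (Fin n) (Fin n) ℂ, X.PosSemidef → 0 ≤ (M * X).trace.re) :
    M.PosSemidef := by
  refine .of_dotProduct_mulVec_nonneg hM fun x => ?_
  have h1 := h _ (posSemidef_vecMulVec_self_star x)
  have h2 : (M * vecMulVec x (star x)).trace = star x ⬝ᵥ (M *ᵥ x) := by
    rw [mul_vecMulVec, trace_vecMulVec, dotProduct_comm]
  rw [h2] at h1
  rw [Complex.nonneg_iff]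
  exact ⟨h1, (hM.im_star_dotProduct_mulVec_self x).symm⟩

theorem isHermitian_cfc (g : ℝ → ℝ) (A : Matrix (Fin n) (Fin n) ℂ) : (cfc g A).IsHermitian :=
  cfc_predicate g A

theorem isHermitian_algebraMap (r : ℝ) :
    (algebraMap ℝ (Matrix (Fin n) (Fin n) ℂ) r).IsHermitian :=
  IsSelfAdjoint.algebraMap _ (.all r)

theorem cfc_add_algebraMap (hA : A.IsHermitian) (g : ℝ → ℝ) (r : ℝ) :
    cfc g (A + algebraMap ℝ (Matrix (Fin n) (Fin n) ℂ) r) = cfc (fun x => g (x + r)) A := by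
  have hA' : IsSelfAdjoint A := hA
  have h1 : A + algebraMap ℝ (Matrix (Fin n) (Fin n) ℂ) r = cfc (fun x => x + r) A := by
    rw [cfc_add_const r (fun x => x) A, cfc_id_eq hA]
  rw [h1, ← cfc_comp' g (fun x => x + r) A ((A.finite_real_spectrum.image _).continuousOn _)]

theorem spectrum_add_algebraMap (r : ℝ) :
    spectrum ℝ (A + algebraMap ℝ (Matrix (Fin n) (Fin n) ℂ) r) = (fun x => x + r) '' spectrum ℝ A := by
  rw [← spectrum.add_singleton_eq]
  simp

end TraceFormula

/-! ### Löwner order and spectra. -/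

section Order

open Matrix MatrixOrder

variable {n : ℕ} {A B C : Matrix (Fin n) (Fin n) ℂ}

theorem spectrum_subset_of_le_of_le {E : Set ℝ} (hE : E.OrdConnected) (hA : A.IsHermitian)
    (hB : B.IsHermitian) (hC : C.IsHermitian) (hAE : spectrum ℝ A ⊆ E) (hCE : spectrum ℝ C ⊆ E)
    (hAB : A ≤ B) (hBC : B ≤ C) : spectrum ℝ B ⊆ E := by
  intro x hx
  have hn : Nonempty (Fin n) := by
    by_contra h
    rw [not_nonempty_iff] at h
    rw [spectrum.of_subsingleton] at hx
    exact hx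
  obtain ⟨m, hm, hm'⟩ := Set.exists_min_image _ (fun x => x) A.finite_real_spectrum
    (ContinuousFunctionalCalculus.spectrum_nonempty A hA)
  obtain ⟨M, hM, hM'⟩ := Set.exists_max_image _ (fun x => x) C.finite_real_spectrum
    (ContinuousFunctionalCalculus.spectrum_nonempty C hC)
  have hA' : IsSelfAdjoint A := hA
  have hB' : IsSelfAdjoint B := hB
  have hC' : IsSelfAdjoint C := hC
  have h1 : m ≤ x := (algebraMap_le_iff_le_spectrum (a := B)).1
    (((algebraMap_le_iff_le_spectrum (a := A)).2 hm').trans hAB) x hx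
  have h2 : x ≤ M := (le_algebraMap_iff_spectrum_le (a := B)).1
    (hBC.trans ((le_algebraMap_iff_spectrum_le (a := C)).2 hM')) x hx
  exact hE.out (hAE hm) (hCE hM) ⟨h1, h2⟩

theorem exists_pos_smul_le_algebraMap (hA : A.IsHermitian) {ε : ℝ} (hε : 0 < ε) :
    ∃ t : ℝ, 0 < t ∧ t • A ≤ algebraMap ℝ (Matrix (Fin n) (Fin n) ℂ) ε := by
  have hA' : IsSelfAdjoint A := hA
  obtain ⟨M, hM⟩ := A.finite_real_spectrum.bddAbove
  have h1 : A ≤ algebraMap ℝ (Matrix (Fin n) (Fin n) ℂ) (max M 1) :=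
    (le_algebraMap_iff_spectrum_le (a := A)).2 fun x hx => (hM hx).trans (le_max_left _ _)
  have hp : 0 < max M 1 := lt_max_of_lt_right one_pos
  refine ⟨ε / max M 1, by positivity, ?_⟩
  have h2 : algebraMap ℝ (Matrix (Fin n) (Fin n) ℂ) ε =
      (ε / max M 1) • algebraMap ℝ (Matrix (Fin n) (Fin n) ℂ) (max M 1) := by
    rw [Algebra.algebraMap_eq_smul_one, Algebra.algebraMap_eq_smul_one, smul_smul,
      div_mul_cancel₀ _ hp.ne']
  rw [h2, Matrix.le_iff, ← smul_sub]
  exact (Matrix.le_iff.1 h1).smul (by positivity)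

end Order

/-! ### Trace minmax functions and matrix monotone subgradients. -/

section Subgradient

open Matrix MatrixOrder

/-- If `f` has a matrix monotone subgradient `g`, then it is trace minmax. -/
theorem MatrixMonotoneOn.traceMinmaxOn {E : Set ℝ} (hE : E.OrdConnected) {f g : ℝ → ℝ}
    (hfg : ∀ x ∈ E, ∀ y ∈ E, g x * (y - x) ≤ f y - f x) (hg : MatrixMonotoneOn E g) :
    TraceMinmaxOn E f := by
  intro n A B C D hA hB hC hAE hBE hCE hAB hBC hD
  set Δ := B - A with hΔ
  have hΔ0 : 0 ≤ Δ := Matrix.nonneg_iff_posSemidef.2 hAB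
  have hΔh : Δ.IsHermitian := hAB.1
  have hDh : D.IsHermitian := hD ▸ (hA.add hC).sub hB
  have hAD : A ≤ D := by
    rw [Matrix.le_iff, hD, show A + C - B - A = C - B by abel]
    exact hBC
  have hDC : D + Δ = C := by rw [hD, hΔ]; abel
  have hAB' : A + Δ = B := by rw [hΔ]; abel
  -- Each step bounds the `f`-increment below by `g (Y k)` and above by `g (X (k + 1))`. Since `g (Y
  -- k) ≥ g (X k)`, the errors telescope to the two terms of order 1/N.
  have key : ∀ N : ℕ, 0 < N →
      (cfc f D).trace.re - (cfc f A).trace.re + (cfc g A * Δ).trace.re / N ≤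
        (cfc f C).trace.re - (cfc f B).trace.re + (cfc g B * Δ).trace.re / N := by
    intro N hN
    have hN' : (0 : ℝ) < N := by exact_mod_cast hN
    let X : ℕ → Matrix (Fin n) (Fin n) ℂ := fun k => A + ((k : ℝ) / N) • Δ
    let Y : ℕ → Matrix (Fin n) (Fin n) ℂ := fun k => D + ((k : ℝ) / N) • Δ
    have hsa : ∀ k : ℕ, (((k : ℝ) / N) • Δ).IsHermitian := fun k =>
      IsSelfAdjoint.smul (.all _) hΔh
    have hXh : ∀ k, (X k).IsHermitian := fun k => hA.add (hsa k)
    have hYh : ∀ k, (Y k).IsHermitian := fun k => hDh.add (hsa k)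
    have hXY : ∀ k, X k ≤ Y k := fun k => by
      rw [Matrix.le_iff, show Y k - X k = D - A by simp only [X, Y]; abel]
      exact Matrix.le_iff.1 hAD
    have hAX : ∀ k, A ≤ X k := fun k => by
      rw [Matrix.le_iff, show X k - A = ((k : ℝ) / N) • Δ by simp only [X]; abel]
      exact hAB.smul (by positivity)
    have hYC : ∀ k ≤ N, Y k ≤ C := fun k hk => by
      rw [Matrix.le_iff, show C - Y k = (1 - (k : ℝ) / N) • Δ by
        rw [← hDC, sub_smul, one_smul]; simp only [Y]; abel]
      refine hAB.smul (sub_nonneg.2 ((div_le_one hN').2 ?_))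
      exact_mod_cast hk
    have hXE : ∀ k ≤ N, spectrum ℝ (X k) ⊆ E := fun k hk =>
      spectrum_subset_of_le_of_le hE hA (hXh k) hC hAE hCE (hAX k) ((hXY k).trans (hYC k hk))
    have hYE : ∀ k ≤ N, spectrum ℝ (Y k) ⊆ E := fun k hk =>
      spectrum_subset_of_le_of_le hE hA (hYh k) hC hAE hCE ((hAX k).trans (hXY k)) (hYC k hk)
    have hstep : ∀ k : ℕ, (((k + 1 : ℕ) : ℝ) / N) = (k : ℝ) / N + (N : ℝ)⁻¹ := fun k => by
      push_cast; ring
    have hXs : ∀ k, X (k + 1) - X k = (N : ℝ)⁻¹ • Δ := fun k => by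
      simp only [X, hstep, add_smul]; abel
    have hYs : ∀ k, Y (k + 1) - Y k = (N : ℝ)⁻¹ • Δ := fun k => by
      simp only [Y, hstep, add_smul]; abel
    have hmono : ∀ k ≤ N, (cfc f (Y 0)).trace.re - (cfc f (X 0)).trace.re
          + (cfc g (X 0) * Δ).trace.re / N ≤
        (cfc f (Y k)).trace.re - (cfc f (X k)).trace.re + (cfc g (X k) * Δ).trace.re / N := by
      intro k
      induction k with
      | zero => intro _; exact le_rfl
      | succ k ih =>
        intro hk
        have hk' : k ≤ N := by omega
        refine (ih hk').trans ?_
        have h1 := trace_cfc_mul_sub_le hfg (hYh k) (hYh (k + 1)) (hYE k hk') (hYE (k + 1) hk)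
        have h2 := trace_cfc_mul_sub_le hfg (hXh (k + 1)) (hXh k) (hXE (k + 1) hk) (hXE k hk')
        rw [hYs] at h1
        rw [← neg_sub, hXs] at h2
        have h3 := (hg n _ _ (hXh k) (hYh k) (hXE k hk') (hYE k hk')
          (Matrix.le_iff.1 (hXY k))).trace_mul_nonneg hAB
        simp only [mul_neg, mul_smul_comm, trace_neg, trace_smul, Complex.neg_re,
          Complex.smul_re, smul_eq_mul, sub_mul, trace_sub, Complex.sub_re] at h1 h2 h3
        have h4 := mul_nonneg (inv_nonneg.2 hN'.le) h3
        rw [div_eq_inv_mul, div_eq_inv_mul]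
        linarith
    have h := hmono N le_rfl
    have e0 : X 0 = A := by simp [X]
    have e1 : Y 0 = D := by simp [Y]
    have e2 : X N = B := by simp [X, div_self hN'.ne', hAB']
    have e3 : Y N = C := by simp [Y, div_self hN'.ne', hDC]
    rwa [e0, e1, e2, e3] at h
  have hlim : ∀ c d : ℝ, Filter.Tendsto (fun N : ℕ => c + d / N) Filter.atTop (nhds c) := by
    intro c d
    simpa using (tendsto_const_nhds (x := c)).add (tendsto_const_div_atTop_nhds_zero_nat d)
  have := le_of_tendsto_of_tendsto (hlim _ _) (hlim _ _)
    (Filter.eventually_atTop.2 ⟨1, fun N hN => key N hN⟩)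
  simp only [trace_add, Complex.add_re]
  linarith

/-- The gap ε leaves room for `t • X` between `A` and `C`. Klein's inequality at `A` and at `C`
encloses the minmax inequality for `B = A + t • X`, `D = C - t • X`; then divide by t. -/
theorem TraceMinmaxOn.trace_cfc_mul_le {E : Set ℝ} (hE : E.OrdConnected) {f g : ℝ → ℝ}
    (hfg : ∀ x ∈ E, ∀ y ∈ E, g x * (y - x) ≤ f y - f x) (hf : TraceMinmaxOn E f)
    {n : ℕ} {A C X : Matrix (Fin n) (Fin n) ℂ} (hA : A.IsHermitian) (hC : C.IsHermitian)
    (hAE : spectrum ℝ A ⊆ E) (hCE : spectrum ℝ C ⊆ E) {ε : ℝ} (hε : 0 < ε)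
    (hAC : A + algebraMap ℝ _ ε ≤ C) (hX : X.PosSemidef) :
    (cfc g A * X).trace.re ≤ (cfc g C * X).trace.re := by
  obtain ⟨t, ht, htX⟩ := exists_pos_smul_le_algebraMap hX.1 hε
  have hP : (t • X).PosSemidef := hX.smul ht.le
  have hP0 : 0 ≤ t • X := Matrix.nonneg_iff_posSemidef.2 hP
  have hB : (A + t • X).IsHermitian := hA.add hP.1
  have hD : (C - t • X).IsHermitian := hC.sub hP.1
  have hAB : A ≤ A + t • X := le_add_of_nonneg_right hP0
  have hBC : A + t • X ≤ C := (by gcongr : A + t • X ≤ _).trans hAC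
  have hDC : C - t • X ≤ C := sub_le_self _ hP0
  have hAD : A ≤ C - t • X := le_sub_iff_add_le.2 hBC
  have hBE := spectrum_subset_of_le_of_le hE hA hB hC hAE hCE hAB hBC
  have hDE := spectrum_subset_of_le_of_le hE hA hD hC hAE hCE hAD hDC
  have h1 := trace_cfc_mul_sub_le hfg hA hB hAE hBE
  have h2 := trace_cfc_mul_sub_le hfg hC hD hCE hDE
  have h3 := hf n A (A + t • X) C (C - t • X) hA hB hC hAE hBE hCE (Matrix.le_iff.1 hAB)
    (Matrix.le_iff.1 hBC) (by abel)
  rw [add_sub_cancel_left] at h1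
  rw [sub_sub_cancel_left] at h2
  simp only [mul_neg, mul_smul_comm, trace_neg, trace_smul, Complex.neg_re,
    Complex.smul_re, smul_eq_mul, trace_add, Complex.add_re] at h1 h2 h3
  exact le_of_mul_le_mul_left (by linarith) ht

/-- A continuous subgradient of a trace minmax function is matrix monotone. -/
theorem TraceMinmaxOn.matrixMonotoneOn {E : Set ℝ} (hE : E.OrdConnected) (hEo : IsOpen E)
    {f g : ℝ → ℝ} (hfg : ∀ x ∈ E, ∀ y ∈ E, g x * (y - x) ≤ f y - f x)
    (hgc : ContinuousOn g E) (hf : TraceMinmaxOn E f) : MatrixMonotoneOn E g := by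
  intro n A C hA hC hAE hCE hAC
  refine ((isHermitian_cfc g C).sub (isHermitian_cfc g A)).posSemidef_of_trace_mul_nonneg ?_
  intro X hX
  rw [sub_mul, trace_sub, Complex.sub_re, sub_nonneg]
  have hshift : ∀ x ∈ E, Filter.Tendsto (fun ε : ℝ => x + ε) (nhdsWithin 0 (Set.Ioi 0)) (nhds x) := by
    intro x _
    have : ContinuousAt (fun ε : ℝ => x + ε) 0 := by fun_prop
    simpa [ContinuousAt] using this.tendsto.mono_left nhdsWithin_le_nhds
  have hlim : Filter.Tendsto (fun ε : ℝ => (cfc g (C + algebraMap ℝ _ ε) * X).trace.re)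
      (nhdsWithin 0 (Set.Ioi 0)) (nhds (cfc g C * X).trace.re) := by
    -- The shift by ε keeps the eigenvectors of `C`, so the weights are fixed and scalar continuity
    -- of `g` suffices.
    rw [← cfc_id_eq hX.1]
    simp only [cfc_add_algebraMap hC, trace_cfc_mul_cfc hC hX.1]
    refine tendsto_finsetSum _ fun i _ => tendsto_finsetSum _ fun j _ => ?_
    have hi := hCE (hC.eigenvalues_mem_spectrum_real i)
    exact ((((hgc.continuousAt (hEo.mem_nhds hi)).tendsto.comp (hshift _ hi)).mul_const _).mul_const _)
  have hmem : ∀ᶠ ε : ℝ in nhdsWithin 0 (Set.Ioi 0), ∀ x ∈ spectrum ℝ C, x + ε ∈ E :=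
    (Filter.eventually_all_finite C.finite_real_spectrum).2 fun x hx =>
      (hshift x (hCE hx)).eventually (hEo.mem_nhds (hCE hx))
  refine ge_of_tendsto hlim ?_
  filter_upwards [hmem, self_mem_nhdsWithin] with ε hε hpos
  refine hf.trace_cfc_mul_le hE hfg hA (hC.add (isHermitian_algebraMap ε)) hAE ?_ hpos ?_ hX
  · rw [spectrum_add_algebraMap]
    rintro _ ⟨x, hx, rfl⟩
    exact hε x hx
  · exact add_le_add_left (Matrix.le_iff.2 hAC) _

end Subgradient

/-! ### From measurable midpoint convexity to convexity. -/

section MidpointConvex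

open Set MeasureTheory Filter

/-- A measurable midpoint convex function is bounded above on compact intervals. -/
theorem bddAbove_image_Icc_of_midpoint_convex {E : Set ℝ} (hEo : IsOpen E) (hE : E.OrdConnected)
    {f : ℝ → ℝ} (hf : AEMeasurable f (volume.restrict E))
    (hmid : ∀ x ∈ E, ∀ y ∈ E, 2 * f ((x + y) / 2) ≤ f x + f y)
    {x y : ℝ} (hx : x ∈ E) (hy : y ∈ E) : BddAbove (f '' Icc x y) := by
  obtain ⟨r₁, hr₁, h₁⟩ := Metric.isOpen_iff.1 hEo x hx
  obtain ⟨r₂, hr₂, h₂⟩ := Metric.isOpen_iff.1 hEo y hy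
  set δ := min r₁ r₂ / 2 with hδ
  have hmin : 0 < min r₁ r₂ := lt_min hr₁ hr₂
  have hδ0 : 0 < δ := by positivity
  have hδ1 : δ < r₁ := by have := min_le_left r₁ r₂; linarith
  have hδ2 : δ < r₂ := by have := min_le_right r₁ r₂; linarith
  set K := Icc (x - δ) (y + δ) with hK
  have hKE : K ⊆ E := hE.out (h₁ (by rw [Real.ball_eq_Ioo]; constructor <;> linarith))
    (h₂ (by rw [Real.ball_eq_Ioo]; constructor <;> linarith))
  set S : ℕ → Set ℝ := fun n => K ∩ f ⁻¹' Ici (n : ℝ) with hS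
  have hSm : ∀ n, NullMeasurableSet (S n) volume := fun n => by
    have h := (hf.mono_measure (Measure.restrict_mono hKE le_rfl)).nullMeasurableSet_preimage
      (measurableSet_Ici (a := (n : ℝ)))
    rw [nullMeasurableSet_restrict measurableSet_Icc.nullMeasurableSet] at h
    rwa [inter_comm] at h
  have hSa : Antitone S := fun m n hmn => inter_subset_inter_right _
    (preimage_mono (Ici_subset_Ici.2 (by exact_mod_cast hmn)))
  have hlim := tendsto_measure_iInter_atTop hSm hSa
    ⟨0, ((measure_mono inter_subset_left).trans_lt measure_Icc_lt_top).ne⟩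
  have hempty : ⋂ n, S n = ∅ := by
    refine eq_empty_of_forall_notMem fun z hz => ?_
    obtain ⟨n, hn⟩ := exists_nat_gt (f z)
    exact absurd (mem_iInter.1 hz n).2 (not_le.2 hn)
  rw [hempty, measure_empty] at hlim
  obtain ⟨n, hn⟩ := (hlim.eventually_lt_const
    (ENNReal.ofReal_pos.2 (half_pos hδ0))).exists
  refine ⟨n, ?_⟩
  rintro _ ⟨z, hz, rfl⟩
  by_contra! hzn
  -- If `f z > n`, midpoint convexity forces `f ≥ n` at one of `z + t`, `z - t`. Thus an interval of
  -- length δ is covered by two copies of `S n`, each of measure below δ/2.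
  have hcover : Icc 0 δ ⊆ (fun t => z + t) ⁻¹' S n ∪ (fun t => z - t) ⁻¹' S n := by
    intro t ht
    have hp : z + t ∈ K := ⟨by linarith [hz.1, ht.1], by linarith [hz.2, ht.2]⟩
    have hm : z - t ∈ K := ⟨by linarith [hz.1, ht.2], by linarith [hz.2, ht.1]⟩
    have h := hmid _ (hKE hp) _ (hKE hm)
    rw [show (z + t + (z - t)) / 2 = z by ring] at h
    rcases le_total (n : ℝ) (f (z + t)) with h' | h'
    · exact Or.inl ⟨hp, h'⟩
    · exact Or.inr ⟨hm, mem_preimage.2 (mem_Ici.2 (by linarith))⟩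
  have hvol := (measure_mono hcover).trans (measure_union_le (μ := volume) _ _)
  have hp := (measurePreserving_add_left (volume : Measure ℝ) z).measure_preimage (hSm n)
  have hm := (volume.measurePreserving_sub_left z).measure_preimage (hSm n)
  rw [hp, hm, Real.volume_Icc] at hvol
  have hlt := hvol.trans_lt (ENNReal.add_lt_add hn hn)
  rw [← ENNReal.ofReal_add (by positivity) (by positivity), sub_zero, add_halves] at hlt
  exact hlt.false

/-- Subtracting the chord leaves φ, midpoint convex and zero at both ends. Doubling the distance to
the nearer end gives 2φ(s) ≤ φ(s'), so the finite supremum of φ is at most half of itself, hence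
nonpositive. -/
theorem convexOn_of_midpoint_convex {E : Set ℝ} (hE : Convex ℝ E) {f : ℝ → ℝ}
    (hbdd : ∀ x ∈ E, ∀ y ∈ E, BddAbove (f '' Icc x y))
    (hmid : ∀ x ∈ E, ∀ y ∈ E, 2 * f ((x + y) / 2) ≤ f x + f y) : ConvexOn ℝ E f := by
  refine LinearOrder.convexOn_of_lt hE fun x hx y hy hxy a b ha hb hab => ?_
  set φ : ℝ → ℝ := fun s => f ((1 - s) * x + s * y) - ((1 - s) * f x + s * f y) with hφ
  have hmem : ∀ s ∈ Icc (0 : ℝ) 1, (1 - s) * x + s * y ∈ Icc x y := fun s hs =>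
    ⟨by nlinarith [hs.1], by nlinarith [hs.2]⟩
  have hIE : Icc x y ⊆ E := hE.ordConnected.out hx hy
  have hφmid : ∀ s ∈ Icc (0 : ℝ) 1, ∀ t ∈ Icc (0 : ℝ) 1, 2 * φ ((s + t) / 2) ≤ φ s + φ t := by
    intro s hs t ht
    have h := hmid _ (hIE (hmem s hs)) _ (hIE (hmem t ht))
    rw [show ((1 - s) * x + s * y + ((1 - t) * x + t * y)) / 2 =
      (1 - (s + t) / 2) * x + (s + t) / 2 * y by ring] at h
    simp only [hφ]
    linarith
  have h0 : φ 0 = 0 := by simp [hφ]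
  have h1 : φ 1 = 0 := by simp [hφ]
  have hφb : BddAbove (φ '' Icc 0 1) := by
    obtain ⟨M, hM⟩ := hbdd x hx y hy
    refine ⟨M + max (-f x) (-f y), ?_⟩
    rintro _ ⟨s, hs, rfl⟩
    have h := hM (mem_image_of_mem f (hmem s hs))
    have h2 := mul_le_mul_of_nonneg_left (le_max_left (-f x) (-f y)) (sub_nonneg.2 hs.2)
    have h3 := mul_le_mul_of_nonneg_left (le_max_right (-f x) (-f y)) hs.1
    simp only [hφ]
    linarith
  have hne : (φ '' Icc 0 1).Nonempty := ⟨φ 0, mem_image_of_mem φ (left_mem_Icc.2 zero_le_one)⟩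
  have hsup : sSup (φ '' Icc 0 1) ≤ sSup (φ '' Icc 0 1) / 2 := by
    refine csSup_le hne ?_
    rintro _ ⟨s, hs, rfl⟩
    rcases le_total s (1 / 2) with h | h
    · have hs' : 2 * s ∈ Icc (0 : ℝ) 1 := ⟨by linarith [hs.1], by linarith⟩
      have h2 := hφmid 0 (left_mem_Icc.2 zero_le_one) (2 * s) hs'
      rw [show (0 + 2 * s) / 2 = s by ring, h0] at h2
      have h3 := le_csSup hφb (mem_image_of_mem φ hs')
      linarith
    · have hs' : 2 * s - 1 ∈ Icc (0 : ℝ) 1 := ⟨by linarith, by linarith [hs.2]⟩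
      have h2 := hφmid 1 (right_mem_Icc.2 zero_le_one) (2 * s - 1) hs'
      rw [show (1 + (2 * s - 1)) / 2 = s by ring, h1] at h2
      have h3 := le_csSup hφb (mem_image_of_mem φ hs')
      linarith
  have hb' : φ b ≤ 0 :=
    (le_csSup hφb (mem_image_of_mem φ ⟨hb.le, by linarith⟩)).trans (by linarith)
  have ha' : a = 1 - b := by linarith
  simp only [hφ] at hb'
  simp only [ha', smul_eq_mul]
  linarith

end MidpointConvex

/-! ### Derivatives of convex functions. -/

section ConvexDeriv

open Set Filter Topology

variable {E : Set ℝ} {f : ℝ → ℝ}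

theorem ConvexOn.deriv_mul_sub_le (hc : ConvexOn ℝ E f)
    (hd : ∀ x ∈ E, DifferentiableAt ℝ f x) :
    ∀ x ∈ E, ∀ y ∈ E, deriv f x * (y - x) ≤ f y - f x := by
  intro x hx y hy
  rcases lt_trichotomy x y with h | rfl | h
  · have h1 := hc.deriv_le_slope hx hy h (hd x hx)
    rwa [slope_def_field, le_div_iff₀ (sub_pos.2 h)] at h1
  · simp
  · have h1 := hc.slope_le_deriv hy hx h (hd x hx)
    rw [slope_def_field, div_le_iff₀ (sub_pos.2 h)] at h1
    linarith

/-- A secant slope from `x` to a fixed nearby `y` approximates `f' x`. It varies continuously when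
`x` moves to `z`, and it bounds `f' z` by convexity: from below for `y` on the left, from above on
the right. -/
theorem ConvexOn.continuousOn_deriv (hc : ConvexOn ℝ E f) (hEo : IsOpen E)
    (hd : ∀ x ∈ E, DifferentiableAt ℝ f x) : ContinuousOn (deriv f) E := by
  intro x hx
  refine ContinuousAt.continuousWithinAt ?_
  have hs := hasDerivAt_iff_tendsto_slope_left_right.1 (hd x hx).hasDerivAt
  have hcont : ∀ y, y ≠ x → ContinuousAt (fun z => slope f z y) x := fun y hy => by
    simp only [slope_def_field]
    exact (continuousAt_const.sub (hd x hx).continuousAt).div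
      (continuousAt_const.sub continuousAt_id) (sub_ne_zero.2 hy)
  refine tendsto_order.2 ⟨fun c hcx => ?_, fun c hcx => ?_⟩
  · obtain ⟨y, ⟨hy, hyE⟩, hyx⟩ := (((hs.1.eventually_const_lt hcx).and
      (nhdsWithin_le_nhds (hEo.mem_nhds hx))).and self_mem_nhdsWithin).exists
    filter_upwards [(hcont y (ne_of_lt hyx)).tendsto.eventually_const_lt hy, lt_mem_nhds hyx,
      hEo.mem_nhds hx] with z hz hyz hzE
    rw [slope_comm] at hz
    exact hz.trans_le (hc.slope_le_deriv hyE hzE hyz (hd z hzE))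
  · obtain ⟨y, ⟨hy, hyE⟩, hyx⟩ := (((hs.2.eventually_lt_const hcx).and
      (nhdsWithin_le_nhds (hEo.mem_nhds hx))).and self_mem_nhdsWithin).exists
    filter_upwards [(hcont y (ne_of_gt hyx)).tendsto.eventually_lt_const hy, gt_mem_nhds hyx,
      hEo.mem_nhds hx] with z hz hyz hzE
    exact (hc.deriv_le_slope hzE hyE hyz (hd z hzE)).trans_lt hz

/-- A convex function whose second symmetric differences at `x` are superadditive for the ratios
`3 / 5` and `4 / 5`, whose sum exceeds `1`, has no corner at `x`. -/
theorem ConvexOn.differentiableAt_of_symmetric_difference (hc : ConvexOn ℝ E f) {x : ℝ}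
    (hx : x ∈ interior E)
    (h : ∀ᶠ ε : ℝ in 𝓝[>] 0, f (x - 4 / 5 * ε) + f (x + 4 / 5 * ε) +
      (f (x - 3 / 5 * ε) + f (x + 3 / 5 * ε)) ≤ 2 * f x + (f (x - ε) + f (x + ε))) :
    DifferentiableAt ℝ f x := by
  set R := derivWithin f (Ioi x) x with hR
  set L := derivWithin f (Iio x) x with hL
  have hr : HasDerivWithinAt f R (Ioi x) x := hc.hasDerivWithinAt_rightDeriv_of_mem_interior hx
  have hl : HasDerivWithinAt f L (Iio x) x := hc.hasDerivWithinAt_leftDeriv_of_mem_interior hx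
  have hrc : ∀ c : ℝ, 0 < c → HasDerivWithinAt (fun ε => f (x + c * ε)) (R * c) (Ioi 0) 0 := by
    intro c hc0
    have h1 : HasDerivWithinAt (fun ε => x + c * ε) c (Ioi 0) 0 := by
      simpa using (((hasDerivAt_id (0 : ℝ)).const_mul c).const_add x).hasDerivWithinAt
    refine HasDerivWithinAt.comp (h₂ := f) (s' := Ioi x) 0 (by simpa using hr) h1 fun ε hε => ?_
    simpa using mul_pos hc0 hε
  have hlc : ∀ c : ℝ, 0 < c → HasDerivWithinAt (fun ε => f (x - c * ε)) (L * -c) (Ioi 0) 0 := by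
    intro c hc0
    have h1 : HasDerivWithinAt (fun ε => x - c * ε) (-c) (Ioi 0) 0 := by
      simpa using (((hasDerivAt_id (0 : ℝ)).const_mul c).const_sub x).hasDerivWithinAt
    refine HasDerivWithinAt.comp (h₂ := f) (s' := Iio x) 0 (by simpa using hl) h1 fun ε hε => ?_
    simpa using mul_pos hc0 hε
  -- The right derivative at 0 is (R - L)(1 - 4/5 - 3/5). Its nonnegativity forces R ≤ L.
  have hT := ((hrc 1 one_pos).add (hlc 1 one_pos)).sub
    (((hlc (4 / 5) (by norm_num)).add (hrc (4 / 5) (by norm_num))).add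
      ((hlc (3 / 5) (by norm_num)).add (hrc (3 / 5) (by norm_num))))
  rw [hasDerivWithinAt_iff_tendsto_slope' (by simp)] at hT
  have hge := ge_of_tendsto (b := 0) hT (by
    filter_upwards [h, self_mem_nhdsWithin] with ε hε hpos
    rw [slope_def_field]
    refine div_nonneg ?_ (by simpa using le_of_lt hpos)
    simp only [Pi.add_apply, Pi.sub_apply, one_mul, mul_zero, add_zero, sub_zero]
    linarith)
  have hLR : L ≤ R := hc.leftDeriv_le_rightDeriv_of_mem_interior hx
  have heq : L = R := by linarith
  rw [heq] at hl
  exact (hasDerivAt_iff_tendsto_slope_left_right.2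
    ⟨(hasDerivWithinAt_iff_tendsto_slope' (by simp)).1 hl,
      (hasDerivWithinAt_iff_tendsto_slope' (by simp)).1 hr⟩).differentiableAt

end ConvexDeriv

/-! ### Test matrices of size one and two. -/

section SmallMatrices

open Matrix

theorem posSemidef_algebraMap {n : ℕ} {r : ℝ} (hr : 0 ≤ r) :
    (algebraMap ℝ (Matrix (Fin n) (Fin n) ℂ) r).PosSemidef := by
  rw [Algebra.algebraMap_eq_smul_one]
  exact PosSemidef.one.smul hr

theorem trace_re_algebraMap_one (r : ℝ) :
    (algebraMap ℝ (Matrix (Fin 1) (Fin 1) ℂ) r).trace.re = r := by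
  simp [Algebra.algebraMap_eq_smul_one]

theorem spectrum_algebraMap_subset {E : Set ℝ} {x : ℝ} (hx : x ∈ E) :
    spectrum ℝ (algebraMap ℝ (Matrix (Fin 1) (Fin 1) ℂ) x) ⊆ E := by
  rw [spectrum.scalar_eq]
  simpa using hx

theorem MatrixMonotoneOn.monotoneOn {E : Set ℝ} {g : ℝ → ℝ} (hg : MatrixMonotoneOn E g) :
    MonotoneOn g E := by
  intro x hx y hy hxy
  have h := hg 1 (algebraMap ℝ _ x) (algebraMap ℝ _ y) (isHermitian_algebraMap x)
    (isHermitian_algebraMap y) (spectrum_algebraMap_subset hx) (spectrum_algebraMap_subset hy)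
    (by rw [LoewnerLE, ← map_sub]; exact posSemidef_algebraMap (sub_nonneg.2 hxy))
  rw [LoewnerLE, cfc_algebraMap, cfc_algebraMap, ← map_sub] at h
  have h2 := (Complex.nonneg_iff.1 h.trace_nonneg).1
  rw [trace_re_algebraMap_one] at h2
  linarith

theorem TraceMinmaxOn.midpoint_convex {E : Set ℝ} (hE : E.OrdConnected) {f : ℝ → ℝ}
    (hf : TraceMinmaxOn E f) : ∀ x ∈ E, ∀ y ∈ E, 2 * f ((x + y) / 2) ≤ f x + f y := by
  intro x hx y hy
  wlog hxy : x ≤ y generalizing x y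
  · rw [add_comm x, add_comm (f x)]
    exact this y hy x hx (le_of_not_ge hxy)
  have hm : (x + y) / 2 ∈ E := hE.out hx hy ⟨by linarith, by linarith⟩
  have h := hf 1 (algebraMap ℝ _ x) (algebraMap ℝ _ ((x + y) / 2)) (algebraMap ℝ _ y)
    (algebraMap ℝ _ ((x + y) / 2)) (isHermitian_algebraMap _)
    (isHermitian_algebraMap _) (isHermitian_algebraMap _) (spectrum_algebraMap_subset hx)
    (spectrum_algebraMap_subset hm) (spectrum_algebraMap_subset hy)
    (by rw [LoewnerLE, ← map_sub]; exact posSemidef_algebraMap (by linarith))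
    (by rw [LoewnerLE, ← map_sub]; exact posSemidef_algebraMap (by linarith))
    (by rw [← map_add, ← map_sub]; congr 1; ring)
  simp only [cfc_algebraMap, ← map_add, trace_re_algebraMap_one] at h
  linarith

/-- The real symmetric matrix `!![a, b; b, d]`, with complex entries. -/
def symmTwo (a b d : ℝ) : Matrix (Fin 2) (Fin 2) ℂ := !![(a : ℂ), (b : ℂ); (b : ℂ), (d : ℂ)]

theorem isHermitian_symmTwo (a b d : ℝ) : (symmTwo a b d).IsHermitian := by
  ext i j
  fin_cases i <;> fin_cases j <;> simp [symmTwo]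

theorem posSemidef_symmTwo_diagonal {a d : ℝ} (ha : 0 ≤ a) (hd : 0 ≤ d) :
    (symmTwo a 0 d).PosSemidef := by
  have h : symmTwo a 0 d = diagonal ![(a : ℂ), (d : ℂ)] := by
    ext i j
    fin_cases i <;> fin_cases j <;> simp [symmTwo]
  rw [h, posSemidef_diagonal_iff]
  intro i
  fin_cases i <;> simpa

theorem symmTwo_sub (a b d a' b' d' : ℝ) :
    symmTwo a b d - symmTwo a' b' d' = symmTwo (a - a') (b - b') (d - d') := by
  ext i j
  fin_cases i <;> fin_cases j <;> simp [symmTwo]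

theorem symmTwo_add (a b d a' b' d' : ℝ) :
    symmTwo a b d + symmTwo a' b' d' = symmTwo (a + a') (b + b') (d + d') := by
  ext i j
  fin_cases i <;> fin_cases j <;> simp [symmTwo]

theorem algebraMap_eq_symmTwo (r : ℝ) :
    algebraMap ℝ (Matrix (Fin 2) (Fin 2) ℂ) r = symmTwo r 0 r := by
  ext i j
  fin_cases i <;> fin_cases j <;> simp [symmTwo, Algebra.algebraMap_eq_smul_one]

theorem spectrum_symmTwo_subset {a b d p q : ℝ} (hs : a + d = p + q) (hp : a * d - b ^ 2 = p * q) :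
    spectrum ℝ (symmTwo a b d) ⊆ {p, q} := by
  intro x hx
  by_contra hne
  rw [Set.mem_insert_iff, Set.mem_singleton_iff, not_or] at hne
  refine hx ?_
  rw [spectrum.mem_resolventSet_iff, algebraMap_eq_symmTwo, symmTwo_sub, Matrix.isUnit_iff_isUnit_det, isUnit_iff_ne_zero]
  have h : (symmTwo (x - a) (0 - b) (x - d)).det = (((x - p) * (x - q) : ℝ) : ℂ) := by
    rw [symmTwo, det_fin_two_of, ← Complex.ofReal_mul, ← Complex.ofReal_mul, ← Complex.ofReal_sub]
    congr 1
    linear_combination hp - x * hs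
  rw [h]
  exact Complex.ofReal_ne_zero.2 (mul_ne_zero (sub_ne_zero.2 hne.1) (sub_ne_zero.2 hne.2))

/-- On the spectrum `f` agrees with its affine interpolant at `p`, `q`, whose trace depends only on
`a + d`. -/
theorem trace_cfc_symmTwo (f : ℝ → ℝ) {a b d p q : ℝ} (hpq : p ≠ q) (hs : a + d = p + q)
    (hp : a * d - b ^ 2 = p * q) : (cfc f (symmTwo a b d)).trace.re = f p + f q := by
  have hpq' : q - p ≠ 0 := sub_ne_zero.2 hpq.symm
  have hM : IsSelfAdjoint (symmTwo a b d) := isHermitian_symmTwo a b d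
  set c := (f q - f p) / (q - p) with hc
  have h : cfc f (symmTwo a b d) = cfc (fun x => c * x + (f p - c * p)) (symmTwo a b d) := by
    refine cfc_congr fun x hx => ?_
    rcases spectrum_symmTwo_subset hs hp hx with rfl | rfl
    · ring
    · simp only [hc]
      field_simp
      ring
  rw [h, cfc_add_const _ _ _, cfc_const_mul _ _ _, cfc_id_eq (isHermitian_symmTwo a b d),
    trace_add, trace_smul, algebraMap_eq_symmTwo, symmTwo, symmTwo, trace_fin_two_of,
    trace_fin_two_of, Complex.add_re, Complex.smul_re, ← Complex.ofReal_add, ← Complex.ofReal_add,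
    Complex.ofReal_re, Complex.ofReal_re, hs, smul_eq_mul]
  have : c * (q - p) = f q - f p := div_mul_cancel₀ _ hpq'
  linarith

theorem TraceMinmaxOn.symmetric_difference_le {E : Set ℝ} (hE : E.OrdConnected) {f : ℝ → ℝ}
    (hf : TraceMinmaxOn E f) {x ε : ℝ} (hε : 0 < ε) (h₁ : x - ε ∈ E) (h₂ : x + ε ∈ E) :
    f (x - 4 / 5 * ε) + f (x + 4 / 5 * ε) + (f (x - 3 / 5 * ε) + f (x + 3 / 5 * ε)) ≤
      2 * f x + (f (x - ε) + f (x + ε)) := by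
  have hmem : ∀ {a b d p q : ℝ}, a + d = p + q → a * d - b ^ 2 = p * q →
      x - ε ≤ p → p ≤ x + ε → x - ε ≤ q → q ≤ x + ε → spectrum ℝ (symmTwo a b d) ⊆ E := by
    intro a b d p q hs hp hp₁ hp₂ hq₁ hq₂ y hy
    rcases spectrum_symmTwo_subset hs hp hy with rfl | rfl
    · exact hE.out h₁ h₂ ⟨hp₁, hp₂⟩
    · exact hE.out h₁ h₂ ⟨hq₁, hq₂⟩
  -- With the orthonormal vectors v = (3/5, 4/5) and w = (4/5, -3/5), A = x - ε vvᵀ and C = A + ε =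
  -- x + ε wwᵀ. B and D add ε to one diagonal entry of A each; their eigenvalues are x ± 4ε/5 and x
  -- ± 3ε/5.
  have h := hf 2 (symmTwo (x - 9 / 25 * ε) (-(12 / 25) * ε) (x - 16 / 25 * ε))
    (symmTwo (x + 16 / 25 * ε) (-(12 / 25) * ε) (x - 16 / 25 * ε))
    (symmTwo (x + 16 / 25 * ε) (-(12 / 25) * ε) (x + 9 / 25 * ε))
    (symmTwo (x - 9 / 25 * ε) (-(12 / 25) * ε) (x + 9 / 25 * ε))
    (isHermitian_symmTwo _ _ _) (isHermitian_symmTwo _ _ _) (isHermitian_symmTwo _ _ _)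
    (hmem (p := x - ε) (q := x) (by ring) (by ring) (by linarith) (by linarith) (by linarith)
      (by linarith))
    (hmem (p := x - 4 / 5 * ε) (q := x + 4 / 5 * ε) (by ring) (by ring) (by linarith)
      (by linarith) (by linarith) (by linarith))
    (hmem (p := x) (q := x + ε) (by ring) (by ring) (by linarith) (by linarith) (by linarith)
      (by linarith))
    (by
      rw [LoewnerLE, symmTwo_sub, sub_self (-(12 / 25) * ε)]
      exact posSemidef_symmTwo_diagonal (by linarith) (by linarith))
    (by
      rw [LoewnerLE, symmTwo_sub, sub_self (-(12 / 25) * ε)]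
      exact posSemidef_symmTwo_diagonal (by linarith) (by linarith))
    (by rw [symmTwo_add, symmTwo_sub]; congr 1 <;> ring)
  rw [trace_add, trace_add, Complex.add_re, Complex.add_re,
    trace_cfc_symmTwo f (p := x - 4 / 5 * ε) (q := x + 4 / 5 * ε) (by linarith) (by ring) (by ring),
    trace_cfc_symmTwo f (p := x - 3 / 5 * ε) (q := x + 3 / 5 * ε) (by linarith) (by ring) (by ring),
    trace_cfc_symmTwo f (p := x - ε) (q := x) (by linarith) (by ring) (by ring),
    trace_cfc_symmTwo f (p := x) (q := x + ε) (by linarith) (by ring) (by ring)] at h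
  linarith

end SmallMatrices

/-! ### The interval and the main theorem. -/

theorem isOpen_realInterval (a b : EReal) : IsOpen (realInterval a b) :=
  isOpen_Ioo.preimage continuous_coe_real_ereal

theorem ordConnected_realInterval (a b : EReal) : (realInterval a b).OrdConnected :=
  ⟨fun _ hx _ hy _ hz => ⟨hx.1.trans_le (EReal.coe_le_coe_iff.2 hz.1),
    (EReal.coe_le_coe_iff.2 hz.2).trans_lt hy.2⟩⟩

theorem mainTheorem3 (a b : EReal) (hab : a < b) (f : ℝ → ℝ)
    (hf : AEMeasurable f (MeasureTheory.volume.restrict (realInterval a b))) :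
    TraceMinmaxOn (realInterval a b) f ↔
      ((∀ x ∈ realInterval a b, DifferentiableAt ℝ f x) ∧
        MatrixMonotoneOn (realInterval a b) (deriv f)) := by
  have hE := ordConnected_realInterval a b
  have hEo := isOpen_realInterval a b
  constructor
  · intro h
    have hmid := h.midpoint_convex hE
    have hc : ConvexOn ℝ (realInterval a b) f := convexOn_of_midpoint_convex hE.convex
      (fun x hx y hy => bddAbove_image_Icc_of_midpoint_convex hEo hE hf hmid hx hy) hmid
    have hd : ∀ x ∈ realInterval a b, DifferentiableAt ℝ f x := by
      intro x hx
      refine hc.differentiableAt_of_symmetric_difference (hEo.interior_eq.symm ▸ hx) ?_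
      have h₁ : ContinuousAt (fun ε : ℝ => x - ε) 0 := by fun_prop
      have h₂ : ContinuousAt (fun ε : ℝ => x + ε) 0 := by fun_prop
      filter_upwards [nhdsWithin_le_nhds (h₁.preimage_mem_nhds (hEo.mem_nhds (by simpa using hx))),
        nhdsWithin_le_nhds (h₂.preimage_mem_nhds (hEo.mem_nhds (by simpa using hx))),
        self_mem_nhdsWithin] with ε hε₁ hε₂ hε
      exact h.symmetric_difference_le hE hε hε₁ hε₂
    exact ⟨hd, h.matrixMonotoneOn hE hEo (hc.deriv_mul_sub_le hd) (hc.continuousOn_deriv hEo hd)⟩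
  · rintro ⟨hd, hg⟩
    have hdo : DifferentiableOn ℝ f (realInterval a b) := fun x hx =>
      (hd x hx).differentiableWithinAt
    have hc : ConvexOn ℝ (realInterval a b) f := by
      refine MonotoneOn.convexOn_of_deriv hE.convex hdo.continuousOn ?_ ?_
      · rwa [hEo.interior_eq]
      · rw [hEo.interior_eq]
        exact hg.monotoneOn
    exact hg.traceMinmaxOn hE (hc.deriv_mul_sub_le hd)
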